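/- \textbf{Setting.} A \emph{W-game} consists of: a set $A$ of agents, partitioned into nonempty sets $(A^p)_{p\in P}$ indexed by a set $P$ of players; a measurable space $(\Omega,\mathcal F)$ (Nature); for each agent $a$ a measurable action space $(U_a,\mathcal U_a)$; for each agent $a$ an information field $\mathcal I_a$, a sub-$\sigma$-field of the product field $\mathcal H$ on the configuration space $H=\prod_{a\in A}U_a\times\Omega$; and, for each player, a preference relation on the measurable maps from $\Omega$ to the probability distributions on $\prod_a U_a$ (which plays no role here). For $h\in H$, $h_a\in U_a$ denotes its coordinate of index $a$. A \emph{pure strategy} of agent $a$ is a map $\lambda_a:H\to U_a$ that is $\mathcal I_a$-measurable. The game is \emph{playable} if for every profile $\lambda=(\lambda_a)_{a\in A}$ of pure strategies and every $\omega\in\Omega$ there is exactly one $u\in\prod_a U_a$ with $u_a=\lambda_a(u,\omega)$ for all $a\in A$; one then sets $S_\lambda(\omega)=(u,\omega)\in H$. A playable game is \emph{$p$-strongly measurable} if for every $B\subset A^p$ and every pure profile $\lambda$, the map $\Omega\times\prod_{b\in B}U_b\to H$, $(\omega,u_B)\mapsto S_{(u_B,\lambda_{-B})}(\omega)$, in which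 the agents of $B$ play the constants $u_B$ and the other agents follow $\lambda$, is measurable. \textbf{Randomized strategies.} Let $W_a=[0,1]$ with its Borel field, $W^p=\prod_{a\in A^p}W_a$, $W=\prod_{a\in A}W_a$, and let $\ell$ be the product on $W$ of the Lebesgue measures. An \emph{A-mixed strategy} of player $p$ is a family $m^p=(m^p_a)_{a\in A^p}$ of maps $m^p_a:W^p\times H\to U_a$, where $m^p_a$ is measurable for the product of the product field on $W^p$ and of $\mathcal I_a$. It is \emph{A-behavioral} if each $m^p_a$ is measurable for the product of the subfield of $W^p$ generated by the coordinate $w_a$ and of $\mathcal I_a$. For a profile $m=(m^q)_{q\in P}$ of A-mixed strategies, each $w\in W$ yields a pure profile $m(w,\cdot)$; set $T_m(\omega,w)=S_{m(w,\cdot)}(\omega)$. The game is \emph{playable and measurable} if it is playable and $T_m:\Omega\times W\to H$ is measurable for every such $m$. For a probability $\nu$ on $\Omega$, let $\mathbb Q^\nu_m=(\nu\otimes\ell)\circ T_m^{-1}$, a probability on $H$. \textbf{Perfect recall.} Suppose that $A^p$ is finite, with $n$ elements. Player $p$ satisfies \emph{perfect recall} if there is a map $\varphi$ from $H$ to the set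 of bijections $\{1,\dots,n\}\to A^p$ such that, for every $k\in\{1,\dots,n\}$ and every injection $\kappa:\{1,\dots,k\}\to A^p$, with $H^\varphi_\kappa=\{h\in H:\varphi(h)|_{\{1,\dots,k\}}=\kappa\}$, $$H^\varphi_\kappa\cap K\in\mathcal I_{\kappa(k)}\qquad\text{for all } K\in\bigvee_{i<k}\bigl(\mathcal U_{\kappa(i)}\vee\mathcal I_{\kappa(i)}\bigr),$$ where $\mathcal U_a$ is identified with the subfield of $\mathcal H$ generated by $h\mapsto h_a$, and the empty supremum (for $k=1$) is the trivial field $\{\emptyset,H\}$. \textbf{Theorem (Kuhn's theorem).} Consider a playable and measurable W-game and a player $p$ such that the game is $p$-strongly measurable. Suppose that $A^p$ is finite, that $(U_a,\mathcal U_a)$ is a standard Borel space for every $a\in A^p$, that $(\Omega,\mathcal F)$ is a standard Borel space, and that for every $a\in A^p$ there are a standard Borel space $(Z_a,\mathcal Z_a)$ and a measurable map $f_a:H\to Z_a$ with $f_a^{-1}(\mathcal Z_a)=\mathcal I_a$. Suppose that player $p$ satisfies perfect recall. Then, for every probability $\nu$ on $(\Omega,\mathcal F)$, every family $m^{-p}=(m^q)_{q\neq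 p}$ of A-mixed strategies of the other players and every A-mixed strategy $m^p$ of player $p$, there exists an A-behavioral strategy $m'^p$ of player $p$ such that $$\mathbb Q^\nu_{(m^p,m^{-p})}=\mathbb Q^\nu_{(m'^p,m^{-p})}.$$ -/

import Mathlib

open MeasureTheory ProbabilityTheory

universe w

/-- The configuration space `(∏ a, U a) × Ω`, with its product `σ`-field. -/
abbrev Config {A : Type*} (Ω : Type*) (U : A → Type*) : Type _ := (∀ a, U a) × Ω

/-- A W-model with set of agents `A`, Nature space `Ω` and action spaces `U a`: each agent is given
an information field, a subfield of the product field on the configuration space. -/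
structure WModel (A : Type*) (Ω : Type*) (U : A → Type*) [MeasurableSpace Ω]
    [∀ a, MeasurableSpace (U a)] where
  info : A → MeasurableSpace (Config Ω U)
  info_le : ∀ a, info a ≤ (inferInstance : MeasurableSpace (Config Ω U))

namespace WModel

variable {A Ω : Type*} {U : A → Type*} [MeasurableSpace Ω] [∀ a, MeasurableSpace (U a)]
  (M : WModel A Ω U)

/-- Pure W-strategies of agent `a`: maps from configurations to actions that are measurable with
respect to the information field of `a`. -/
def PureStrategy (a : A) : Type _ := {s : Config Ω U → U a // Measurable[M.info a] s}

/-- The pure W-strategy of agent `a` that always plays `c`. -/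
def constStrategy (a : A) (c : U a) : M.PureStrategy a :=
  ⟨fun _ => c, @measurable_const _ _ _ (M.info a) c⟩

/-- Playability: for every profile of pure W-strategies and every state of Nature, the closed-loop
equations have one and only one solution. -/
def Playable : Prop :=
  ∀ (s : ∀ a, M.PureStrategy a) (ω : Ω), ∃! u : ∀ a, U a, ∀ a, u a = (s a).1 (u, ω)

variable {M}

/-- The solution map of a playable W-model. -/
noncomputable def solution (hM : M.Playable) (s : ∀ a, M.PureStrategy a) (ω : Ω) : Config Ω U :=
  ((hM s ω).choose, ω)

open Classical in
/-- The partial solution map: the agents in `B` play the constants `x.2`, the other agents follow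
the profile `s` (the strategies in `s` of the agents in `B` are not used). -/
noncomputable def partialSolution (hM : M.Playable) (B : Set A) (s : ∀ a, M.PureStrategy a)
    (x : Ω × (∀ b : B, U b)) : Config Ω U :=
  solution hM (fun a => if h : a ∈ B then M.constStrategy a (x.2 ⟨a, h⟩) else s a) x.1

/-- `B`-strong measurability of a playable W-model. -/
def StronglyMeasurableOn (hM : M.Playable) (B : Set A) : Prop :=
  ∀ B' : Set A, B' ⊆ B → ∀ s : ∀ a, M.PureStrategy a, Measurable (partialSolution hM B' s)

variable (M)

/-- The choice field of agent `a`: what the agent did, together with what the agent knew. -/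
@[reducible] def choiceField (a : A) : MeasurableSpace (Config Ω U) :=
  MeasurableSpace.comap (fun h : Config Ω U => h.1 a) inferInstance ⊔ M.info a

end WModel

/-- A W-game with set of players `P`: a W-model, a partition of the agents into nonempty sets
indexed by the players (given by the map `owner` that sends an agent to her player), and, for
each player, a preference relation on measurable maps from Nature to probability distributions
on action profiles. -/
structure WGame (P : Type*) (A : Type*) (Ω : Type*) (U : A → Type*) [MeasurableSpace Ω]
    [∀ a, MeasurableSpace (U a)] extends WModel A Ω U where
  owner : A → P
  owner_surjective : Function.Surjective owner
  pref : P → {κ : Kernel Ω (∀ a, U a) // IsMarkovKernel κ} →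
    {κ : Kernel Ω (∀ a, U a) // IsMarkovKernel κ} → Prop

namespace WGame

variable {P A Ω : Type*} {U : A → Type*} [MeasurableSpace Ω] [∀ a, MeasurableSpace (U a)]
  (G : WGame P A Ω U)

/-- The set of executive agents of player `p`. -/
def agents (p : P) : Set A := {a | G.owner a = p}

/-- The randomizing device of player `p`: one copy of `[0,1]` for each of her agents. -/
abbrev Device (p : P) : Type _ := G.agents p → unitInterval

/-- A-mixed strategies of player `p`: families of maps `m a : Device p × Config → U a`, measurable
for the product of the field of the device and of the information field of `a`. -/
def MixedStrategy (p : P) : Type _ :=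
  {m : ∀ a : G.agents p, G.Device p × Config Ω U → U a //
    ∀ a : G.agents p,
      Measurable[(inferInstance : MeasurableSpace (G.Device p)).prod (G.info a)] (m a)}

variable {G}

/-- A-behavioral strategies: the action of `a` uses only the randomizing component of `a`, that
is, the field of the device is replaced by the subfield generated by the coordinate `a`. -/
def MixedStrategy.IsBehavioral {p : P} (m : G.MixedStrategy p) : Prop :=
  ∀ a : G.agents p,
    Measurable[(MeasurableSpace.comap (fun w : G.Device p => w a) inferInstance).prod
      (G.info a)] (m.1 a)

variable (G)

/-- A-mixed strategy profiles. -/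
abbrev MixedProfile : Type _ := ∀ p, G.MixedStrategy p

variable {G}

open Classical in
/-- The profile `(m', m^{-p})`: player `p` plays `m'`, the other players play as in `m`. -/
noncomputable def MixedProfile.replace (m : G.MixedProfile) (p : P) (m' : G.MixedStrategy p) :
    G.MixedProfile :=
  Function.update m p m'

/-- The profile of pure W-strategies `m (w, ·)`, for a realization `w` of all devices. -/
def MixedProfile.pure (m : G.MixedProfile) (w : A → unitInterval) (a : A) :
    G.toWModel.PureStrategy a :=
  ⟨fun h => (m (G.owner a)).1 ⟨a, rfl⟩ (fun b => w b, h),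
    @Measurable.comp _ _ _ (G.info a)
      ((inferInstance : MeasurableSpace (G.Device (G.owner a))).prod (G.info a)) _ _ _
      ((m (G.owner a)).2 ⟨a, rfl⟩)
      (@measurable_prodMk_left _ _ (inferInstance : MeasurableSpace (G.Device (G.owner a)))
        (G.info a) _)⟩

/-- The map `T_m : (ω, w) ↦ S_{m (w, ·)} (ω)`. -/
noncomputable def MixedProfile.outcome (m : G.MixedProfile) (hG : G.toWModel.Playable)
    (x : Ω × (A → unitInterval)) : Config Ω U :=
  WModel.solution hG (m.pure x.2) x.1

/-- A playable W-game is playable and measurable when all maps `T_m` are measurable. -/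
def IsMeasurable (hG : G.toWModel.Playable) : Prop :=
  ∀ m : G.MixedProfile, Measurable (m.outcome hG)

/-- The product of the Lebesgue measures on the randomizing devices of all agents. -/
noncomputable def deviceLaw (A : Type*) : Measure (A → unitInterval) :=
  Measure.infinitePi fun _ : A => (volume : Measure unitInterval)

/-- The pushforward of `ν ⊗ ℓ` by `T_m` on the configuration space (a probability measure as soon
as `T_m` is measurable and `ν` is a probability measure). -/
noncomputable def law (hG : G.toWModel.Playable) (ν : Measure Ω) (m : G.MixedProfile) :
    Measure (Config Ω U) :=
  (ν.prod (deviceLaw A)).map (m.outcome hG)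

variable (G)

/-- The `k`-orderings of player `p`: injections of `{0, …, k - 1}` into her agents. -/
abbrev PartialOrdering (p : P) (k : ℕ) : Type _ := Fin k ↪ G.agents p

/-- The total orderings of player `p` (bijections as soon as she has finitely many agents). -/
abbrev TotalOrdering (p : P) : Type _ := G.PartialOrdering p (Nat.card (G.agents p))

variable {G}

/-- The configurations at which the first `k` agents, in the order given by the
configuration-ordering `φ`, are those of `κ`, in this order. -/
def orderedSet {p : P} (φ : Config Ω U → G.TotalOrdering p) {k : ℕ}
    (hk : k ≤ Nat.card (G.agents p)) (κ : G.PartialOrdering p k) : Set (Config Ω U) :=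
  {h | (Fin.castLEEmb hk).trans (φ h) = κ}

variable (G)

/-- Perfect recall of player `p`, assumed to have finitely many agents. An ordering in
`Σ^p_{k + 1}` has last element `κ (Fin.last k)` and first elements `κ i.castSucc`, `i < k`. -/
def PerfectRecall (p : P) : Prop :=
  ∃ φ : Config Ω U → G.TotalOrdering p,
    ∀ (k : ℕ) (hk : k + 1 ≤ Nat.card (G.agents p)) (κ : G.PartialOrdering p (k + 1))
      (H : Set (Config Ω U)),
      MeasurableSet[⨆ i : Fin k, G.choiceField (κ i.castSucc)] H →
        MeasurableSet[G.info (κ (Fin.last k))] (orderedSet φ hk κ ∩ H)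

/-- The Borel measurable functional information assumption for player `p`. -/
def BorelInformation (p : P) : Prop :=
  ∃ (Z : G.agents p → Type w) (mZ : ∀ a, MeasurableSpace (Z a))
    (f : ∀ a, Config Ω U → Z a),
    ∀ a : G.agents p, StandardBorelSpace (Z a) ∧ Measurable (f a) ∧
      MeasurableSpace.comap (f a) (mZ a) = G.info a

end WGame

/-!
Kuhn's theorem for games in product form: a player with perfect recall loses nothing by letting
her agents randomize independently.

All the players other than `p`, with their devices, are merged with Nature into an environment `x`
that responds to the actions of `p`. Playability excludes that an agent has information on her own
action (`WModel.solution_mem_of_mem`). Together with perfect recall this yields causality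
(`signal_pastActions`): the signal `Z k`, made of the name of the agent of `p` in position `k` and
of her information, is a function of `x` and of the actions taken before, hence, since these are
recalled, a function of `x`, of `Z (k - 1)` and of the action in position `k - 1`. Conversely
`Z k` determines `Z (k - 1)` and this action (`OrderedRecall.exists_recall`).

In such a sequential situation, the private device `w` of the player is conditionally independent
of `x` given `Z k`, for every `k`. This is proved by induction, the posterior law of `w` being
updated by disintegration (`IsPosterior.step`). Therefore the action in position `k`, a function
of `w` and `Z k`, has a conditional law given `(x, Z k)` that depends on `Z k` only. The behavioral
strategy lets the agent in position `k` draw from this law, with her own uniform variable; her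
position is a function of her information (`OrderedRecall.exists_position`). Since the agents in
different positions use different coordinates of the device, the draw is independent of `(x, Z k)`
(`lintegral_selected_coordinate`), and the laws of `(x, Z k)` under both strategies coincide by
induction on `k` (`lintegral_eq_of_independent_randomization`). The last signal and the last action
determine, together with `x`, the whole configuration.

Information and actions take values in standard Borel spaces, so they are encoded in the unit
interval (`WGame.BorelInformation.exists_encoding`). This makes the signals of all agents live in
one space. It also gives the joint measurability in `x` and in the actions of the response of the
environment: this response is the outcome of the strategy of `p` in which each agent plays the
action encoded by her device, so its measurability is an instance of that of the maps `T_m`.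
-/

/-! ### Posterior laws of the randomizing device along a sequence of signals -/

/-- The kernel `ρ` is a posterior law of the second component `w` given the signal `Z`, and this
posterior does not change when the first component `x` is observed in addition to `Z`. In other
words, `x` and `w` are conditionally independent given `Z`, and `ρ` is the conditional law of `w`. -/
def IsPosterior {X W T : Type*} [MeasurableSpace X] [MeasurableSpace W] [MeasurableSpace T]
    (P : Measure (X × W)) (Z : X × W → T) (ρ : Kernel T W) : Prop :=
  ∀ G : X × T × W → ENNReal, Measurable G →
    ∫⁻ q, G (q.1, Z q, q.2) ∂P = ∫⁻ q, ∫⁻ w, G (q.1, Z q, w) ∂ρ (Z q) ∂P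

section Posterior

variable {X W T J : Type*} [MeasurableSpace X] [MeasurableSpace W] [MeasurableSpace T]
  [MeasurableSpace J]

/-- Under a product measure, a function of `x` alone gives no information on `w`. -/
theorem isPosterior_prior (μ : Measure X) (ℓ : Measure W) [SFinite μ] [IsProbabilityMeasure ℓ]
    {F : X → T} (hF : Measurable F) {Z : X × W → T} (hZ : ∀ q, Z q = F q.1) :
    IsPosterior (μ.prod ℓ) Z (Kernel.const T ℓ) := by
  intro G hG
  obtain rfl : Z = fun q => F q.1 := funext hZ
  have h1 : Measurable fun q : X × W => G (q.1, F q.1, q.2) := by fun_prop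
  have h2 : Measurable fun q : X × W => ∫⁻ w, G (q.1, F q.1, w) ∂ℓ :=
    Measurable.lintegral_prod_right' (f := fun q : (X × W) × W => G (q.1.1, F q.1.1, q.2))
      (by fun_prop)
  simp only [Kernel.const_apply]
  rw [lintegral_prod _ h1.aemeasurable, lintegral_prod _ h2.aemeasurable]
  simp

/-- One step of Bayesian updating. The posterior given `Z` is turned into a posterior given the
next signal `Z'`, provided that `Z'` is a function of `x`, of `Z` and of the action `g (w, Z)`, and
that `Z'` remembers both `Z` and this action. -/
theorem IsPosterior.step [StandardBorelSpace W] [Nonempty W] [StandardBorelSpace J]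
    {P : Measure (X × W)} {Z Z' : X × W → T}
    {g : W × T → J} (hg : Measurable g) {F : X × T × J → T} (hF : Measurable F)
    {r : T → T × J} (hr : Measurable r)
    (hZ' : ∀ q, Z' q = F (q.1, Z q, g (q.2, Z q)))
    (hrZ' : ∀ q, r (Z' q) = (Z q, g (q.2, Z q)))
    {ρ : Kernel T W} [IsMarkovKernel ρ] (hρ : IsPosterior P Z ρ) :
    ∃ ρ' : Kernel T W, IsMarkovKernel ρ' ∧ IsPosterior P Z' ρ' := by
  -- the joint law of the action and of the device given the current signal
  let κ : Kernel T (J × W) :=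
    (Kernel.id ×ₖ ρ).map fun y : T × W => (g (y.2, y.1), y.2)
  have hm : Measurable fun y : T × W => (g (y.2, y.1), y.2) := by fun_prop
  have hκ : ∀ z (f : J × W → ENNReal), Measurable f →
      ∫⁻ y, f y ∂κ z = ∫⁻ w, f (g (w, z), w) ∂ρ z := by
    intro z f hf
    rw [Kernel.lintegral_map _ hm _ hf]
    exact Kernel.lintegral_id_prod (f := fun y : T × W => f (g (y.2, y.1), y.2)) (by fun_prop) ρ z
  have : IsMarkovKernel κ := Kernel.IsMarkovKernel.map _ hm
  have hdis : ∀ z (f : J × W → ENNReal), Measurable f →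
      ∫⁻ w, (∫⁻ w', f (g (w, z), w') ∂κ.condKernel (z, g (w, z))) ∂ρ z =
        ∫⁻ w, f (g (w, z), w) ∂ρ z := by
    intro z f hf
    have h3 : Measurable fun j : J => ∫⁻ w', f (j, w') ∂κ.condKernel (z, j) :=
      (Measurable.lintegral_kernel_prod_right' (κ := κ.condKernel)
        (f := fun y : (T × J) × W => f (y.1.2, y.2)) (by fun_prop)).comp
        (measurable_prodMk_left (x := z))
    rw [← hκ z f hf, ← lintegral_condKernel hf z, Kernel.lintegral_fst _ _ h3]
    exact (hκ z _ (h3.comp measurable_fst)).symm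
  refine ⟨κ.condKernel.comap r hr, inferInstance, fun G hG => ?_⟩
  simp only [Kernel.comap_apply, hrZ']
  simp only [hZ']
  -- the right-hand side as a function of `x`, of the current signal and of the action
  let G' : X × T × W → ENNReal := fun y =>
    ∫⁻ w', G (y.1, F (y.1, y.2.1, g (y.2.2, y.2.1)), w') ∂κ.condKernel (y.2.1, g (y.2.2, y.2.1))
  have hG' : Measurable G' := by
    have h4 : Measurable fun y : X × T × J =>
        ∫⁻ w', G (y.1, F y, w') ∂κ.condKernel y.2 := by
      have := (Measurable.lintegral_kernel_prod_right'
        (κ := κ.condKernel.comap (fun y : X × T × J => y.2) measurable_snd)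
        (f := fun y : (X × T × J) × W => G (y.1.1, F y.1, y.2)) (by fun_prop))
      simpa only [Kernel.comap_apply] using! this
    exact h4.comp (g := fun y : X × T × J => ∫⁻ w', G (y.1, F y, w') ∂κ.condKernel y.2)
      (f := fun y : X × T × W => (y.1, y.2.1, g (y.2.2, y.2.1))) (by fun_prop)
  rw [hρ (fun y => G (y.1, F (y.1, y.2.1, g (y.2.2, y.2.1)), y.2.2)) (by fun_prop)]
  refine Eq.trans ?_ (hρ G' hG').symm
  refine lintegral_congr fun q => ?_
  exact (hdis (Z q) (fun y => G (q.1, F (q.1, Z q, y.1), y.2)) (by fun_prop)).symm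

/-- The law of the action given the signal, deduced from a posterior law of the device. -/
noncomputable def actionKernel (ρ : Kernel T W) (g : W × T → J) : Kernel T J :=
  (Kernel.id ×ₖ ρ).map fun y : T × W => g (y.2, y.1)

theorem lintegral_actionKernel (ρ : Kernel T W) [IsSFiniteKernel ρ] {g : W × T → J}
    (hg : Measurable g) (z : T) {f : J → ENNReal} (hf : Measurable f) :
    ∫⁻ j, f j ∂actionKernel ρ g z = ∫⁻ w, f (g (w, z)) ∂ρ z := by
  rw [actionKernel, Kernel.lintegral_map _ (by fun_prop) _ hf]
  exact Kernel.lintegral_id_prod (f := fun y : T × W => f (g (y.2, y.1))) (by fun_prop) ρ z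

theorem isMarkovKernel_actionKernel (ρ : Kernel T W) [IsMarkovKernel ρ] {g : W × T → J}
    (hg : Measurable g) : IsMarkovKernel (actionKernel ρ g) :=
  Kernel.IsMarkovKernel.map _ (by fun_prop)

/-- Under perfect recall (each signal determines the previous signal and the previous action), the
device `w` is at each time conditionally independent of `x` given the current signal. -/
theorem exists_posterior_sequence [StandardBorelSpace W] [Nonempty W] [StandardBorelSpace J]
    (μ : Measure X) (ℓ : Measure W) [SFinite μ] [IsProbabilityMeasure ℓ] (n : ℕ)
    {Z : ℕ → X × W → T}
    {g : W × T → J} (hg : Measurable g)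
    {F₀ : X → T} (hF₀ : Measurable F₀)
    {F : ℕ → X × T × J → T} (hF : ∀ k, k + 1 < n → Measurable (F k))
    {r : ℕ → T → T × J} (hr : ∀ k, k + 1 < n → Measurable (r k))
    (hZ₀ : 0 < n → ∀ q, Z 0 q = F₀ q.1)
    (hZs : ∀ k, k + 1 < n → ∀ q, Z (k + 1) q = F k (q.1, Z k q, g (q.2, Z k q)))
    (hrZ : ∀ k, k + 1 < n → ∀ q, r k (Z (k + 1) q) = (Z k q, g (q.2, Z k q))) :
    ∀ k < n, ∃ ρ : Kernel T W, IsMarkovKernel ρ ∧ IsPosterior (μ.prod ℓ) (Z k) ρ := by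
  intro k
  induction k with
  | zero => exact fun h => ⟨_, inferInstance, isPosterior_prior μ ℓ hF₀ (hZ₀ h)⟩
  | succ k ih =>
    intro h
    obtain ⟨ρ, hρ, hρ'⟩ := ih (by omega)
    exact hρ'.step hg (hF k h) (hr k h) (hZs k h) (hrZ k h)

end Posterior

/-! ### Resampling coordinates of the randomizing devices -/

open Classical in
/-- Overriding the coordinates in `S` by `v` in the point `w`. -/
noncomputable def overrideOn {A J : Type*} (S : Set A) (w : A → J) (v : S → J) : A → J :=
  fun a => if h : a ∈ S then v ⟨a, h⟩ else w a

theorem measurable_overrideOn {A J : Type*} [MeasurableSpace J] (S : Set A) :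
    Measurable fun y : (A → J) × (S → J) => overrideOn S y.1 y.2 := by
  refine measurable_pi_lambda _ fun a => ?_
  by_cases h : a ∈ S
  · simp only [overrideOn, h, dite_true]; fun_prop
  · simp only [overrideOn, h, dite_false]; fun_prop

theorem overrideOn_coe {A J : Type*} (S : Set A) (w : A → J) (v : S → J) :
    (fun b : S => overrideOn S w v b) = v := by
  funext b
  simp [overrideOn]

instance isProbabilityMeasure_deviceLaw (A : Type*) :
    IsProbabilityMeasure (WGame.deviceLaw A) := by
  unfold WGame.deviceLaw; infer_instance

/-- Replacing finitely or infinitely many uniform coordinates by independent uniform ones preserves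
the joint law. -/
theorem map_overrideOn {A : Type*} (S : Set A) :
    ((WGame.deviceLaw A).prod (WGame.deviceLaw S)).map (fun y => overrideOn S y.1 y.2) =
      WGame.deviceLaw A := by
  classical
  refine Measure.eq_infinitePi _ fun s t ht => ?_
  rw [Measure.map_apply (measurable_overrideOn S) (MeasurableSet.pi s.countable_toSet
    fun i _ => ht i)]
  have hpre : (fun y : (A → unitInterval) × (S → unitInterval) => overrideOn S y.1 y.2) ⁻¹'
      (Set.pi s t) = (Set.pi (s.filter (· ∉ S) : Finset A) t) ×ˢ
        (Set.pi ((s.subtype (· ∈ S) : Finset S) : Set S) fun a => t a) := by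
    ext ⟨x, y⟩
    simp only [Set.mem_preimage, Set.mem_pi, Set.mem_prod, Finset.coe_filter, Set.mem_ofPred_eq,
      Finset.mem_coe, Finset.mem_subtype, overrideOn]
    refine ⟨fun h => ⟨fun a ha => ?_, fun a ha => ?_⟩, fun h a ha => ?_⟩
    · simpa [ha.2] using h a ha.1
    · simpa using h a ha
    · by_cases hS : a ∈ S
      · simpa [hS] using h.2 ⟨a, hS⟩ ha
      · simpa [hS] using h.1 a ⟨ha, hS⟩
  rw [hpre, Measure.prod_prod, WGame.deviceLaw, WGame.deviceLaw,
    Measure.infinitePi_pi _ fun i _ => ht i,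
    Measure.infinitePi_pi (t := fun a : S => t a) _ fun i _ => ht i,
    Finset.prod_subtype_eq_prod_filter (f := fun i => volume (t i)), mul_comm,
    Finset.prod_filter_mul_prod_filter_not]

/-- Replacing one uniform coordinate by an independent uniform one preserves the joint law. -/
theorem map_update_deviceLaw {N : Type*} [DecidableEq N] (a : N) :
    ((WGame.deviceLaw N).prod (volume : Measure unitInterval)).map
      (fun y => Function.update y.1 a y.2) = WGame.deviceLaw N := by
  refine Measure.eq_infinitePi _ fun s t ht => ?_
  have hm : Measurable fun y : (N → unitInterval) × unitInterval => Function.update y.1 a y.2 := by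
    fun_prop
  rw [Measure.map_apply hm (MeasurableSet.pi s.countable_toSet fun i _ => ht i)]
  by_cases ha : a ∈ s
  · have hpre : (fun y : (N → unitInterval) × unitInterval => Function.update y.1 a y.2) ⁻¹'
        (Set.pi s t) = (Set.pi (s.erase a : Finset N) t) ×ˢ t a := by
      ext ⟨x, y⟩
      simp only [Set.mem_preimage, Set.mem_pi, Set.mem_prod, Finset.coe_erase, Set.mem_sdiff,
        Finset.mem_coe, Set.mem_singleton_iff]
      refine ⟨fun h => ⟨fun b hb => by simpa [hb.2] using h b hb.1, by simpa using h a ha⟩,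
        fun h b hb => ?_⟩
      by_cases hab : b = a
      · subst hab; simpa using h.2
      · simpa [hab] using h.1 b ⟨hb, hab⟩
    rw [hpre, Measure.prod_prod, WGame.deviceLaw, Measure.infinitePi_pi _ fun i _ => ht i,
      Finset.prod_erase_mul _ _ ha]
  · have hpre : (fun y : (N → unitInterval) × unitInterval => Function.update y.1 a y.2) ⁻¹'
        (Set.pi s t) = (Set.pi s t) ×ˢ Set.univ := by
      ext ⟨x, y⟩
      simp only [Set.mem_preimage, Set.mem_pi, Set.mem_prod, Finset.mem_coe, Set.mem_univ, and_true]
      refine forall₂_congr fun b hb => ?_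
      have : b ≠ a := fun h => ha (h ▸ hb)
      simp [this]
    rw [hpre, Measure.prod_prod, WGame.deviceLaw, Measure.infinitePi_pi _ fun i _ => ht i]
    simp

/-- A random choice `α ∘ f` of a coordinate of `w` gives a uniform variable independent of `f`,
provided that `f` does not depend on the coordinate chosen. -/
theorem lintegral_selected_coordinate {X N S : Type*} [MeasurableSpace X] [Fintype N]
    [DecidableEq N] [MeasurableSpace S]
    [MeasurableSpace N] [MeasurableSingletonClass N]
    (μ : Measure X) [SFinite μ] {f : X × (N → unitInterval) → S} (hf : Measurable f)
    {α : S → N} (hα : Measurable α)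
    (hind : ∀ x w c, f (x, Function.update w (α (f (x, w))) c) = f (x, w))
    {G : S × unitInterval → ENNReal} (hG : Measurable G) :
    ∫⁻ q, G (f q, q.2 (α (f q))) ∂(μ.prod (WGame.deviceLaw N)) =
      ∫⁻ q, ∫⁻ c, G (f q, c) ∂volume ∂(μ.prod (WGame.deviceLaw N)) := by
  -- the events `α ∘ f = a` form a finite partition
  have hsplit : ∀ Φ : X × (N → unitInterval) → ENNReal, Measurable Φ →
      ∫⁻ q, Φ q ∂(μ.prod (WGame.deviceLaw N)) =
        ∑ a, ∫⁻ q, (if α (f q) = a then Φ q else 0) ∂(μ.prod (WGame.deviceLaw N)) := by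
    intro Φ hΦ
    rw [← lintegral_finsetSum]
    · simp
    · intro a _
      exact Measurable.ite ((hα.comp hf) (measurableSet_singleton a)) hΦ measurable_const
  have hinv : ∀ x w a c, α (f (x, Function.update w a c)) = a ↔ α (f (x, w)) = a := by
    intro x w a c
    refine ⟨fun h => ?_, fun h => ?_⟩
    · have := hind x (Function.update w a c) (w a)
      rw [h] at this
      simp only [Function.update_idem, Function.update_eq_self] at this
      rw [this, h]
    · subst h; rw [hind]
  have hmeval : Measurable fun q : X × (N → unitInterval) => q.2 (α (f q)) := by
    have : (fun q : X × (N → unitInterval) => q.2 (α (f q))) =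
        (fun y : N × (N → unitInterval) => y.2 y.1) ∘ fun q => (α (f q), q.2) := rfl
    rw [this]
    exact (measurable_from_prod_countable_right fun a => measurable_pi_apply a).comp
      ((hα.comp hf).prodMk measurable_snd)
  have hL : Measurable fun q : X × (N → unitInterval) => ∫⁻ c, G (f q, c) ∂volume :=
    Measurable.lintegral_prod_right' (f := fun y : (X × (N → unitInterval)) × unitInterval =>
      G (f y.1, y.2)) (by fun_prop)
  rw [hsplit (fun q => G (f q, q.2 (α (f q)))) (hG.comp (hf.prodMk hmeval)), hsplit _ hL]
  refine Finset.sum_congr rfl fun a _ => ?_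
  -- resample the coordinate `a`
  have hmf : ∀ x, Measurable fun w : N → unitInterval => f (x, w) := fun x => by fun_prop
  rw [lintegral_prod, lintegral_prod]
  rotate_left
  · exact (Measurable.ite ((hα.comp hf) (measurableSet_singleton a)) hL
      measurable_const).aemeasurable
  · exact (Measurable.ite ((hα.comp hf) (measurableSet_singleton a))
      (hG.comp (hf.prodMk hmeval)) measurable_const).aemeasurable
  refine lintegral_congr fun x => ?_
  have hm1 : Measurable fun w : N → unitInterval =>
      if α (f (x, w)) = a then G (f (x, w), w (α (f (x, w)))) else 0 :=
    Measurable.ite ((hα.comp (hmf x)) (measurableSet_singleton a))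
      ((hG.comp (hf.prodMk hmeval)).comp measurable_prodMk_left) measurable_const
  conv_lhs => rw [← map_update_deviceLaw a]
  rw [lintegral_map hm1 (by fun_prop)]
  refine (lintegral_prod _ (hm1.comp (by fun_prop : Measurable
    fun y : (N → unitInterval) × unitInterval => Function.update y.1 a y.2)).aemeasurable).trans ?_
  refine lintegral_congr fun w => ?_
  by_cases h : α (f (x, w)) = a
  · have h' : ∀ c, f (x, Function.update w a c) = f (x, w) := fun c => by subst h; exact hind x w c
    simp [h', h]
  · simp [hinv, h]

/-! ### Replacing a joint randomization by independent ones -/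

section Sequence

variable {X T J N : Type*} [MeasurableSpace X] [MeasurableSpace T] [MeasurableSpace J]

/-- The conditional law of the `k`-th action given the `k`-th signal is realized by a measurable
function `γ k` of this signal and of one uniform variable, and the action so produced is
conditionally independent of `x` given the signal, as the original one is. -/
theorem exists_independent_randomization {W : Type*} [MeasurableSpace W] [StandardBorelSpace W]
    [Nonempty W] [StandardBorelSpace J] [Nonempty J]
    (μ : Measure X) (ℓ : Measure W) [SFinite μ] [IsProbabilityMeasure ℓ] (n : ℕ)
    {Z : ℕ → X × W → T}
    {g : W × T → J} (hg : Measurable g)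
    {F₀ : X → T} (hF₀ : Measurable F₀)
    {F : ℕ → X × T × J → T} (hF : ∀ k, k + 1 < n → Measurable (F k))
    {r : ℕ → T → T × J} (hr : ∀ k, k + 1 < n → Measurable (r k))
    (hZ₀ : 0 < n → ∀ q, Z 0 q = F₀ q.1)
    (hZs : ∀ k, k + 1 < n → ∀ q, Z (k + 1) q = F k (q.1, Z k q, g (q.2, Z k q)))
    (hrZ : ∀ k, k + 1 < n → ∀ q, r k (Z (k + 1) q) = (Z k q, g (q.2, Z k q))) :
    ∀ k < n, ∃ γ : T × unitInterval → J, Measurable γ ∧ ∀ G : X × T × J → ENNReal, Measurable G →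
      ∫⁻ q, G (q.1, Z k q, g (q.2, Z k q)) ∂(μ.prod ℓ) =
        ∫⁻ q, ∫⁻ c, G (q.1, Z k q, γ (Z k q, c)) ∂volume ∂(μ.prod ℓ) := by
  intro k hk
  obtain ⟨ρ, hρ, hpost⟩ :=
    exists_posterior_sequence μ ℓ n hg hF₀ hF hr hZ₀ hZs hrZ k hk
  have := isMarkovKernel_actionKernel ρ hg
  obtain ⟨γ, hγ, hγρ⟩ := Kernel.exists_measurable_map_eq_unitInterval (actionKernel ρ g)
  refine ⟨Function.uncurry γ, hγ, fun G hG => ?_⟩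
  rw [hpost (fun y => G (y.1, y.2.1, g (y.2.2, y.2.1))) (by fun_prop)]
  refine lintegral_congr fun q => ?_
  have h1 : Measurable fun j => G (q.1, Z k q, j) := by fun_prop
  have h2 : Measurable (γ (Z k q)) := hγ.comp measurable_prodMk_left
  rw [← lintegral_actionKernel ρ hg (Z k q) h1, ← hγρ, lintegral_map h1 h2]
  rfl

/-- Two sequences of signals with the same dynamics `F` have the same laws, jointly with `x` and
with the actions, if the actions of the first have the conditional law encoded by `γ`, and those
of the second are obtained from `γ` by using at each time a coordinate of the device that was not
used before. -/
theorem lintegral_eq_of_independent_randomization [Fintype N] [DecidableEq N]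
    [MeasurableSpace N] [MeasurableSingletonClass N]
    (μ : Measure X) [SFinite μ] (n : ℕ)
    {Z Z' : ℕ → X × (N → unitInterval) → T} (hZ' : ∀ k < n, Measurable (Z' k))
    {u : ℕ → X × (N → unitInterval) → J}
    {γ : ℕ → T × unitInterval → J} (hγ : ∀ k < n, Measurable (γ k))
    {sel : T → N} (hsel : Measurable sel)
    {F₀ : X → T} {F : ℕ → X × T × J → T} (hF : ∀ k, k + 1 < n → Measurable (F k))
    (hZ₀ : 0 < n → ∀ q, Z 0 q = F₀ q.1)
    (hZs : ∀ k, k + 1 < n → ∀ q, Z (k + 1) q = F k (q.1, Z k q, u k q))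
    (hZ'₀ : 0 < n → ∀ q, Z' 0 q = F₀ q.1)
    (hZ's : ∀ k, k + 1 < n → ∀ q,
      Z' (k + 1) q = F k (q.1, Z' k q, γ k (Z' k q, q.2 (sel (Z' k q)))))
    (hne : ∀ i j, i < j → j < n → ∀ q, sel (Z' i q) ≠ sel (Z' j q))
    (hu : ∀ k < n, ∀ G : X × T × J → ENNReal, Measurable G →
      ∫⁻ q, G (q.1, Z k q, u k q) ∂(μ.prod (WGame.deviceLaw N)) =
        ∫⁻ q, ∫⁻ c, G (q.1, Z k q, γ k (Z k q, c)) ∂volume ∂(μ.prod (WGame.deviceLaw N)))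
    {k : ℕ} (hk : k < n) {G : X × T × J → ENNReal} (hG : Measurable G) :
    ∫⁻ q, G (q.1, Z k q, u k q) ∂(μ.prod (WGame.deviceLaw N)) =
      ∫⁻ q, G (q.1, Z' k q, γ k (Z' k q, q.2 (sel (Z' k q)))) ∂(μ.prod (WGame.deviceLaw N)) := by
  -- the `k`-th signal does not depend on the coordinate selected at time `k`
  have hind : ∀ k < n, ∀ x w c, ∀ i ≤ k,
      Z' i (x, Function.update w (sel (Z' k (x, w))) c) = Z' i (x, w) := by
    intro k hk x w c i
    induction i with
    | zero => intro _; rw [hZ'₀ (by omega), hZ'₀ (by omega)]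
    | succ i ih =>
      intro hi
      rw [hZ's i (by omega), hZ's i (by omega), ih (by omega)]
      dsimp only
      rw [Function.update_of_ne (hne i k (by omega) hk (x, w))]
  have hu' : ∀ k < n, ∀ G : X × T × J → ENNReal, Measurable G →
      ∫⁻ q, G (q.1, Z' k q, γ k (Z' k q, q.2 (sel (Z' k q)))) ∂(μ.prod (WGame.deviceLaw N)) =
        ∫⁻ q, ∫⁻ c, G (q.1, Z' k q, γ k (Z' k q, c)) ∂volume ∂(μ.prod (WGame.deviceLaw N)) := by
    intro k hk G hG
    have hk1 := hγ k hk
    have hk2 := hZ' k hk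
    exact lintegral_selected_coordinate μ (f := fun q => (q.1, Z' k q)) (by fun_prop)
      (α := fun y => sel y.2) (by fun_prop)
      (fun x w c => by simp only [hind k hk x w c k le_rfl])
      (G := fun y => G (y.1.1, y.1.2, γ k (y.1.2, y.2))) (by fun_prop)
  -- equality of the laws of `(x, Z k)` carries over to the actions, then to the next signal
  have key : ∀ k < n, ∀ H : X × T → ENNReal, Measurable H →
      ∫⁻ q, H (q.1, Z k q) ∂(μ.prod (WGame.deviceLaw N)) =
        ∫⁻ q, H (q.1, Z' k q) ∂(μ.prod (WGame.deviceLaw N)) := by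
    intro k
    induction k with
    | zero => intro h H _; simp only [hZ₀ h, hZ'₀ h]
    | succ k ih =>
      intro h H hH
      have h1 := hF k h
      have h2 := hγ k (by omega)
      simp only [hZs k h, hZ's k h]
      rw [hu k (by omega) (fun y => H (y.1, F k y)) (by fun_prop),
        hu' k (by omega) (fun y => H (y.1, F k y)) (by fun_prop)]
      exact ih (by omega) (fun y => ∫⁻ c, H (y.1, F k (y.1, y.2, γ k (y.2, c))) ∂volume)
        (Measurable.lintegral_prod_right'
          (f := fun y : (X × T) × unitInterval =>
            H (y.1.1, F k (y.1.1, y.1.2, γ k (y.1.2, y.2)))) (by fun_prop))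
  have h2 := hγ k hk
  rw [hu k hk G hG, hu' k hk G hG]
  exact key k hk (fun y => ∫⁻ c, G (y.1, y.2, γ k (y.2, c)) ∂volume)
    (Measurable.lintegral_prod_right'
      (f := fun y : (X × T) × unitInterval => G (y.1.1, y.1.2, γ k (y.1.2, y.2))) (by fun_prop))

end Sequence

/-! ### Perfect recall in terms of signals -/

section Recall

variable {H N : Type*} {n : ℕ}

/-- The agent in position `k` at the configuration `h`, positions being counted from `0`; the value
for `n ≤ k` is irrelevant. -/
noncomputable def agentAt [Nonempty N] (φ : H → Fin n ↪ N) (k : ℕ) (h : H) : N :=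
  if hk : k < n then φ h ⟨k, hk⟩ else Classical.arbitrary N

theorem agentAt_of_lt [Nonempty N] (φ : H → Fin n ↪ N) {k : ℕ} (hk : k < n) (h : H) :
    agentAt φ k h = φ h ⟨k, hk⟩ := by simp [agentAt, hk]

theorem agentAt_ne [Nonempty N] (φ : H → Fin n ↪ N) {i j : ℕ} (hij : i < j) (hj : j < n) (h : H) :
    agentAt φ i h ≠ agentAt φ j h := by
  rw [agentAt_of_lt φ hj, agentAt_of_lt φ (hij.trans hj)]
  intro he
  have := (φ h).injective he
  simp only [Fin.mk.injEq] at this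
  omega

theorem exists_agentAt_eq [Nonempty N] [Finite N] (φ : H → Fin n ↪ N) (hn : n = Nat.card N) (h : H)
    (b : N) : ∃ k < n, agentAt φ k h = b := by
  have hb : Function.Bijective (φ h) :=
    (Nat.bijective_iff_injective_and_card _).2 ⟨(φ h).injective, by simp [hn]⟩
  obtain ⟨⟨k, hk⟩, rfl⟩ := hb.2 b
  exact ⟨k, hk, agentAt_of_lt φ hk h⟩

/-- The information of the agent in position `k`, together with the name of this agent. The
function `y b` encodes the information of the agent `b`. -/
noncomputable def signal [Nonempty N] (φ : H → Fin n ↪ N) (y : N → H → unitInterval) (k : ℕ)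
    (h : H) : N × unitInterval :=
  (agentAt φ k h, y (agentAt φ k h) h)

/-- The action of the agent in position `k`. The function `u b` encodes the action of `b`. -/
noncomputable def actionAt [Nonempty N] (φ : H → Fin n ↪ N) (u : N → H → unitInterval) (k : ℕ)
    (h : H) : unitInterval :=
  u (agentAt φ k h) h

/-- Perfect recall for the ordering `φ`, when information and actions are encoded by `y`
and `u`. -/
def OrderedRecall (φ : H → Fin n ↪ N) (y u : N → H → unitInterval) : Prop :=
  ∀ (k : ℕ) (hk : k + 1 ≤ n) (κ : Fin (k + 1) ↪ N) (S : Set H),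
    MeasurableSet[⨆ i : Fin k, (MeasurableSpace.comap (u (κ i.castSucc)) inferInstance ⊔
      MeasurableSpace.comap (y (κ i.castSucc)) inferInstance)] S →
    MeasurableSet[MeasurableSpace.comap (y (κ (Fin.last k))) inferInstance]
      ({h | (Fin.castLEEmb hk).trans (φ h) = κ} ∩ S)

variable [Nonempty N] [Finite N] {φ : H → Fin n ↪ N} {y u : N → H → unitInterval}

theorem OrderedRecall.measurableSet_agentAt_eq (hrec : OrderedRecall φ y u) {k : ℕ} (hk : k < n)
    (b : N) : MeasurableSet[MeasurableSpace.comap (y b) inferInstance] {h | agentAt φ k h = b} := by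
  have : {h | agentAt φ k h = b} = ⋃ κ : {κ : Fin (k + 1) ↪ N // κ (Fin.last k) = b},
      {h | (Fin.castLEEmb (Nat.succ_le_of_lt hk)).trans (φ h) = κ.1} := by
    ext h
    simp only [Set.mem_ofPred_eq, Set.mem_iUnion]
    refine ⟨fun he => ⟨⟨_, ?_⟩, rfl⟩, ?_⟩
    · rw [← he, agentAt_of_lt φ hk]; rfl
    · rintro ⟨⟨κ, hκ⟩, rfl⟩
      rw [← hκ, agentAt_of_lt φ hk]; rfl
  rw [this]
  refine @MeasurableSet.iUnion _ _ (MeasurableSpace.comap (y b) inferInstance) _ _ ?_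
  rintro ⟨κ, rfl⟩
  simpa using! hrec k hk κ Set.univ (@MeasurableSet.univ _ _)

/-- The position of an agent is a function of her information. -/
theorem OrderedRecall.exists_position (hrec : OrderedRecall φ y u) (hn : n = Nat.card N) :
    ∃ pos : N → unitInterval → ℕ, (∀ b, Measurable (pos b)) ∧
      ∀ h, ∀ k < n, pos (agentAt φ k h) (y (agentAt φ k h) h) = k := by
  have hpos : ∀ (b : N) (h : H), ∃ k < n, agentAt φ k h = b := fun b h =>
    exists_agentAt_eq φ hn h b
  choose P hP hPb using hpos
  have huniq : ∀ b h k, k < n → (P b h = k ↔ agentAt φ k h = b) := by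
    intro b h k hk
    refine ⟨fun e => e ▸ hPb b h, fun e => ?_⟩
    rcases lt_trichotomy (P b h) k with hl | hl | hl
    · exact absurd ((hPb b h).trans e.symm) (agentAt_ne φ hl hk h)
    · exact hl
    · exact absurd (e.trans (hPb b h).symm) (agentAt_ne φ hl (hP b h) h)
  have hmeas : ∀ b, Measurable[MeasurableSpace.comap (y b) inferInstance] (P b) := by
    intro b
    refine @measurable_to_countable' _ _ _ _ (MeasurableSpace.comap (y b) inferInstance) _ fun k => ?_
    by_cases hk : k < n
    · convert hrec.measurableSet_agentAt_eq hk b using 1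
      ext h
      exact huniq b h k hk
    · convert @MeasurableSet.empty _ (MeasurableSpace.comap (y b) inferInstance) using 1
      ext h
      simp only [Set.mem_preimage, Set.mem_singleton_iff, Set.mem_empty_iff_false, iff_false]
      exact fun e => hk (e ▸ hP b h)
  have hfac : ∀ b, ∃ f : unitInterval → ℕ, Measurable f ∧ P b = f ∘ y b := fun b =>
    (hmeas b).exists_eq_measurable_comp
  choose pos hpos hposP using hfac
  refine ⟨pos, hpos, fun h k hk => ?_⟩
  have := congrFun (hposP (agentAt φ k h)) h
  rw [Function.comp_apply] at this
  rw [← this, huniq _ _ _ hk]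

variable [MeasurableSpace N]

theorem OrderedRecall.measurable_signal [MeasurableSpace H] (hrec : OrderedRecall φ y u)
    (hy : ∀ b, Measurable (y b)) {k : ℕ} (hk : k < n) : Measurable (signal φ y k) := by
  intro S hS
  have : signal φ y k ⁻¹' S = ⋃ b, {h | agentAt φ k h = b} ∩ (fun h => (b, y b h)) ⁻¹' S := by
    ext h
    simp [signal]
  rw [this]
  refine MeasurableSet.iUnion fun b => MeasurableSet.inter ?_ ?_
  · exact (hy b).comap_le _ (hrec.measurableSet_agentAt_eq hk b)
  · exact (measurable_const.prodMk (hy b)) hS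

/-- Each signal determines, in a measurable way, the previous signal and the previous action. -/
theorem OrderedRecall.exists_recall [MeasurableSingletonClass N] (hrec : OrderedRecall φ y u)
    {k : ℕ} (hk : k + 1 < n) :
    ∃ r : N × unitInterval → (N × unitInterval) × unitInterval, Measurable r ∧
      ∀ h, r (signal φ y (k + 1) h) = (signal φ y k h, actionAt φ u k h) := by
  have hmeas : Measurable[MeasurableSpace.comap (signal φ y (k + 1)) inferInstance]
      fun h => (signal φ y k h, actionAt φ u k h) := by
    intro S hS
    -- split according to the first `k + 2` agents
    have hsplit : (fun h => (signal φ y k h, actionAt φ u k h)) ⁻¹' S =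
        ⋃ κ : Fin (k + 2) ↪ N, {h | (Fin.castLEEmb (Nat.succ_le_of_lt hk)).trans (φ h) = κ} ∩
          (fun h => ((κ (Fin.last k).castSucc, y (κ (Fin.last k).castSucc) h),
            u (κ (Fin.last k).castSucc) h)) ⁻¹' S := by
      ext h
      simp only [Set.mem_preimage, Set.mem_iUnion, Set.mem_inter_iff, Set.mem_ofPred_eq,
        exists_eq_left']
      rw [signal, actionAt, agentAt_of_lt φ (by omega : k < n)]
      rfl
    rw [hsplit]
    refine @MeasurableSet.iUnion _ _ (MeasurableSpace.comap (signal φ y (k + 1)) inferInstance)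
      _ _ fun κ => ?_
    have hK : MeasurableSet[⨆ i : Fin (k + 1),
        (MeasurableSpace.comap (u (κ i.castSucc)) inferInstance ⊔
          MeasurableSpace.comap (y (κ i.castSucc)) inferInstance)]
        ((fun h => ((κ (Fin.last k).castSucc, y (κ (Fin.last k).castSucc) h),
            u (κ (Fin.last k).castSucc) h)) ⁻¹' S) := by
      refine (le_iSup (fun i : Fin (k + 1) =>
        (MeasurableSpace.comap (u (κ i.castSucc)) inferInstance ⊔
          MeasurableSpace.comap (y (κ i.castSucc)) inferInstance)) (Fin.last k)) _ ?_
      have h1 : MeasurableSpace.comap (fun h => ((κ (Fin.last k).castSucc,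
          y (κ (Fin.last k).castSucc) h), u (κ (Fin.last k).castSucc) h)) inferInstance ≤
          MeasurableSpace.comap (u (κ (Fin.last k).castSucc)) inferInstance ⊔
          MeasurableSpace.comap (y (κ (Fin.last k).castSucc)) inferInstance := by
        refine Measurable.comap_le ?_
        refine Measurable.prodMk (Measurable.prodMk measurable_const ?_) ?_
        · exact measurable_iff_comap_le.2 le_sup_right
        · exact measurable_iff_comap_le.2 le_sup_left
      exact h1 _ ⟨S, hS, rfl⟩
    obtain ⟨S', hS', he⟩ := hrec (k + 1) hk κ _ hK
    refine ⟨{κ (Fin.last (k + 1))} ×ˢ S', (measurableSet_singleton _).prod hS', ?_⟩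
    rw [← he]
    have hag : ∀ h, (Fin.castLEEmb (Nat.succ_le_of_lt hk)).trans (φ h) = κ →
        agentAt φ (k + 1) h = κ (Fin.last (k + 1)) := by
      rintro h rfl
      rw [agentAt_of_lt φ hk]; rfl
    ext h
    simp only [Set.mem_preimage, Set.mem_prod, Set.mem_singleton_iff, signal]
    refine ⟨fun hh => hh.1 ▸ hh.2, fun hh => ?_⟩
    have hh' : h ∈ y (κ (Fin.last (k + 1))) ⁻¹' S' := hh
    rw [he] at hh'
    rw [hag h hh'.1]
    exact ⟨rfl, hh⟩
  cases isEmpty_or_nonempty H with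
  | inl hH => exact ⟨fun z => (z, 0), by fun_prop, fun h => hH.elim h⟩
  | inr hH =>
    obtain ⟨r, hr, hr'⟩ := hmeas.exists_eq_measurable_comp
    exact ⟨r, hr, fun h => (congrFun hr' h).symm⟩

end Recall

/-! ### Causality -/

open Classical in
/-- The reconstruction of all past actions, the last one included, from the current signal and the
current action, where `r k` recovers the signal and the action at time `k` from the signal at
time `k + 1`. -/
noncomputable def reconstruct {N : Type*}
    (r : ℕ → N × unitInterval → (N × unitInterval) × unitInterval) :
    ℕ → (N × unitInterval) × unitInterval → N → unitInterval
  | 0, z, b => if z.1.1 = b then z.2 else 0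
  | k + 1, z, b => if z.1.1 = b then z.2 else reconstruct r k (r k z.1) b

theorem measurable_reconstruct {N : Type*} [MeasurableSpace N] [MeasurableSingletonClass N]
    {r : ℕ → N × unitInterval → (N × unitInterval) × unitInterval} {k : ℕ}
    (hr : ∀ j < k, Measurable (r j)) : Measurable (reconstruct r k) := by
  induction k with
  | zero =>
    refine measurable_pi_lambda _ fun b => ?_
    exact Measurable.ite (measurable_fst.fst (measurableSet_singleton b)) measurable_snd
      measurable_const
  | succ k ih =>
    refine measurable_pi_lambda _ fun b => ?_
    have h1 := ih fun j hj => hr j (by omega)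
    have h2 := hr k (by omega)
    exact Measurable.ite (measurable_fst.fst (measurableSet_singleton b)) measurable_snd
      (by fun_prop)

section Causality

variable {X H N : Type*} {n : ℕ} [Nonempty N] {φ : H → Fin n ↪ N} {y u : N → H → unitInterval}

open Classical in
/-- The actions of the first `k` agents at the configuration `h`, completed by default actions. -/
noncomputable def pastActions (φ : H → Fin n ↪ N) (u : N → H → unitInterval) (k : ℕ) (h : H) :
    N → unitInterval :=
  fun b => if ∃ i < k, agentAt φ i h = b then u b h else 0

theorem pastActions_succ_of_ne {k : ℕ} {h : H} {b : N} (hb : b ≠ agentAt φ k h) :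
    pastActions φ u (k + 1) h b = pastActions φ u k h b := by
  have : (∃ i < k + 1, agentAt φ i h = b) ↔ ∃ i < k, agentAt φ i h = b := by
    refine ⟨fun ⟨i, hi, he⟩ => ⟨i, ?_, he⟩, fun ⟨i, hi, he⟩ => ⟨i, by omega, he⟩⟩
    rcases Nat.lt_succ_iff_lt_or_eq.1 hi with h' | rfl
    · exact h'
    · exact absurd he.symm hb
  classical exact if_congr this rfl rfl

theorem reconstruct_eq {r : ℕ → N × unitInterval → (N × unitInterval) × unitInterval} {k : ℕ}
    {h : H} (hr : ∀ j < k, r j (signal φ y (j + 1) h) = (signal φ y j h, actionAt φ u j h)) :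
    reconstruct r k (signal φ y k h, actionAt φ u k h) = pastActions φ u (k + 1) h := by
  induction k with
  | zero =>
    funext b
    by_cases hb : agentAt φ 0 h = b
    · subst hb; simp [reconstruct, pastActions, signal, actionAt]
    · simp [reconstruct, pastActions, signal, hb]
  | succ k ih =>
    have ih := congrFun (ih fun j hj => hr j (by omega))
    funext b
    rw [reconstruct, hr k (by omega), ih]
    by_cases hb : agentAt φ (k + 1) h = b
    · subst hb
      have : ∃ i < k + 1 + 1, agentAt φ i h = agentAt φ (k + 1) h := ⟨k + 1, by omega, rfl⟩
      rw [show pastActions φ u (k + 1 + 1) h (agentAt φ (k + 1) h) = u (agentAt φ (k + 1) h) h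
        from if_pos this]
      simp [signal, actionAt]
    · rw [if_neg (by simpa [signal] using hb), pastActions_succ_of_ne (Ne.symm hb)]

theorem pastActions_all [Finite N] (hn : n = Nat.card N) (h : H) :
    pastActions φ u n h = fun b => u b h := by
  ext b
  simp [pastActions, exists_agentAt_eq φ hn h b]

theorem signal_eq_of_le {r : ℕ → N × unitInterval → (N × unitInterval) × unitInterval}
    (hr : ∀ j, j + 1 < n → ∀ h, r j (signal φ y (j + 1) h) = (signal φ y j h, actionAt φ u j h))
    {k : ℕ} (hk : k < n) {h h' : H} (he : signal φ y k h' = signal φ y k h) {i : ℕ} (hi : i ≤ k) :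
    signal φ y i h' = signal φ y i h := by
  induction k with
  | zero => obtain rfl : i = 0 := by omega
            exact he
  | succ k ih =>
    rcases Nat.of_le_succ hi with hi | rfl
    · refine ih (by omega) ?_ hi
      have h1 := hr k hk h
      rw [← he, hr k hk h'] at h1
      exact congrArg Prod.fst h1
    · exact he

/-- Causality: the signal at time `k` depends on `x` and on the first `k` actions only. This holds
because no agent has information on her own action, while by perfect recall she knows all that
was known before her. -/
theorem signal_pastActions [Finite N] (hn : n = Nat.card N) (hrec : OrderedRecall φ y u)
    {r : ℕ → N × unitInterval → (N × unitInterval) × unitInterval}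
    (hr : ∀ j, j + 1 < n → ∀ h, r j (signal φ y (j + 1) h) = (signal φ y j h, actionAt φ u j h))
    {R : (N → unitInterval) → H}
    (hself : ∀ v v' a, (∀ b ≠ a, v b = v' b) → y a (R v) = y a (R v'))
    {h : H} (hR : R (fun b => u b h) = h) {k : ℕ} (hk : k < n) :
    signal φ y k (R (pastActions φ u k h)) = signal φ y k h := by
  -- erasing the action in position `k` preserves the signals up to time `k`
  have hstep : ∀ v v', ∀ k < n, (∀ b ≠ agentAt φ k (R v), v b = v' b) → ∀ i ≤ k,
      signal φ y i (R v') = signal φ y i (R v) := by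
    intro v v' k hk hv i hi
    refine signal_eq_of_le hr hk ?_ hi
    have hyv := hself v v' _ hv
    obtain ⟨S, hS, he⟩ := hrec.measurableSet_agentAt_eq hk (agentAt φ k (R v))
    have h1 : agentAt φ k (R v') = agentAt φ k (R v) := by
      have h2 : R v ∈ {h | agentAt φ k h = agentAt φ k (R v)} := rfl
      rw [← he, Set.mem_preimage, hyv, ← Set.mem_preimage, he] at h2
      exact h2
    rw [signal, signal, h1, hyv]
  -- erase the actions one after the other, starting from the last one
  have hall : ∀ j k, k + j = n → ∀ i ≤ k, i < n →
      signal φ y i (R (pastActions φ u k h)) = signal φ y i h := by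
    intro j
    induction j with
    | zero =>
      intro k hkn i _ _
      rw [show k = n from hkn, pastActions_all hn, hR]
    | succ j ih =>
      intro k hkj i hi hin
      have h1 := ih (k + 1) (by omega)
      have ha : agentAt φ k (R (pastActions φ u (k + 1) h)) = agentAt φ k h :=
        congrArg Prod.fst (h1 k (by omega) (by omega))
      have h2 := hstep (pastActions φ u (k + 1) h) (pastActions φ u k h) k (by omega)
        (fun b hb => pastActions_succ_of_ne (ha ▸ hb)) i hi
      rw [h2, h1 i (by omega) hin]
  exact hall (n - k) k (by omega) k le_rfl hk

end Causality

/-! ### Kuhn's theorem with encoded information and actions -/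

/-- Kuhn's theorem for one player, all information and actions being encoded in the unit interval.
The map `R` sends a state of the environment and a profile of actions of the player to the
resulting configuration, and `h₁` is the outcome of a mixed strategy `g`. The maps `γ k` describe,
for the agent in position `k`, the response to her information using a uniform variable; any
outcome `h₂` in which the agents so respond, each with her own coordinate of the device, has
the same law as `h₁`. The map `proj b` is a projection onto the set of codes of actions of `b`. -/
theorem exists_response_lintegral_eq {X H N : Type*} [MeasurableSpace X] [MeasurableSpace H]
    [Nonempty N] [Finite N] [MeasurableSpace N] [MeasurableSingletonClass N]
    (μ : Measure X) [SFinite μ]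
    {n : ℕ} (hn : n = Nat.card N) {φ : H → Fin n ↪ N} {y u : N → H → unitInterval}
    (hrec : OrderedRecall φ y u) (hy : ∀ b, Measurable (y b))
    {proj : N → unitInterval → unitInterval} (hproj : ∀ b, Measurable (proj b))
    (hproj_idem : ∀ b c, proj b (proj b c) = proj b c) (hproj_u : ∀ b h, proj b (u b h) = u b h)
    {R : X × (N → unitInterval) → H} (hR : Measurable R)
    (hself : ∀ x v v' a, (∀ b ≠ a, v b = v' b) → y a (R (x, v)) = y a (R (x, v')))
    {g : N → (N → unitInterval) × unitInterval → unitInterval} (hg : ∀ b, Measurable (g b))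
    {h₁ : X × (N → unitInterval) → H} (hh₁ : ∀ q, R (q.1, fun b => u b (h₁ q)) = h₁ q)
    (hg₁ : ∀ q b, u b (h₁ q) = g b (q.2, y b (h₁ q))) :
    ∃ γ : ℕ → (N × unitInterval) × unitInterval → unitInterval, (∀ k, Measurable (γ k)) ∧
      (∀ k z, proj z.1.1 (γ k z) = γ k z) ∧
      ∀ h₂ : X × (N → unitInterval) → H, Measurable h₂ →
        (∀ q, R (q.1, fun b => u b (h₂ q)) = h₂ q) →
        (∀ k < n, ∀ q, actionAt φ u k (h₂ q) =
          γ k (signal φ y k (h₂ q), q.2 (agentAt φ k (h₂ q)))) →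
        ∀ G : H → ENNReal, Measurable G →
          ∫⁻ q, G (h₁ q) ∂(μ.prod (WGame.deviceLaw N)) =
            ∫⁻ q, G (h₂ q) ∂(μ.prod (WGame.deviceLaw N)) := by
  classical
  have := Fintype.ofFinite N
  have hrex : ∀ k, ∃ r : N × unitInterval → (N × unitInterval) × unitInterval, Measurable r ∧
      (k + 1 < n → ∀ h, r (signal φ y (k + 1) h) = (signal φ y k h, actionAt φ u k h)) := by
    intro k
    by_cases hk : k + 1 < n
    · obtain ⟨r, hr, hr'⟩ := hrec.exists_recall hk
      exact ⟨r, hr, fun _ => hr'⟩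
    · exact ⟨fun z => (z, 0), by fun_prop, fun h => absurd h hk⟩
  choose r hr hr' using hrex
  have hrm : ∀ k, Measurable (reconstruct r k) := fun k => measurable_reconstruct fun j _ => hr j
  -- the dynamics of the signals
  let F₀ : X → N × unitInterval := fun x => signal φ y 0 (R (x, fun _ => 0))
  let F : ℕ → X × (N × unitInterval) × unitInterval → N × unitInterval := fun k q =>
    signal φ y (k + 1) (R (q.1, reconstruct r k q.2))
  have hcaus : ∀ x h, R (x, fun b => u b h) = h → ∀ k < n,
      signal φ y k (R (x, pastActions φ u k h)) = signal φ y k h := fun x h hh k hk =>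
    signal_pastActions hn hrec hr' (R := fun v => R (x, v)) (hself x) hh hk
  have hrecon : ∀ h, ∀ k < n, reconstruct r k (signal φ y k h, actionAt φ u k h) =
      pastActions φ u (k + 1) h := fun h k hk => reconstruct_eq fun j hj => hr' j (by omega) h
  have hF₀ : 0 < n → Measurable F₀ := fun h =>
    (hrec.measurable_signal hy h).comp (hR.comp (by fun_prop))
  have hF : ∀ k, k + 1 < n → Measurable (F k) := fun k hk => by
    have h1 := hrm k
    exact (hrec.measurable_signal hy hk).comp (hR.comp (by fun_prop))
  have hdyn₀ : 0 < n → ∀ x h, R (x, fun b => u b h) = h → signal φ y 0 h = F₀ x := by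
    intro hn0 x h hh
    rw [← hcaus x h hh 0 hn0]
    simp only [F₀]
    rw [show pastActions φ u 0 h = fun _ => 0 from funext fun b => by simp [pastActions]]
  have hdyn : ∀ k, k + 1 < n → ∀ x h, R (x, fun b => u b h) = h →
      signal φ y (k + 1) h = F k (x, signal φ y k h, actionAt φ u k h) := by
    intro k hk x h hh
    simp only [F]
    rw [hrecon h k (by omega), hcaus x h hh _ hk]
  -- the mixed strategy, as a function of the signal
  let g' : (N → unitInterval) × N × unitInterval → unitInterval := fun z => g z.2.1 (z.1, z.2.2)
  have hg' : Measurable g' := by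
    have : Measurable fun z : N × (N → unitInterval) × unitInterval => g z.1 z.2 :=
      measurable_from_prod_countable_right hg
    exact this.comp (by fun_prop :
      Measurable fun z : (N → unitInterval) × N × unitInterval => (z.2.1, z.1, z.2.2))
  have hact : ∀ k q, actionAt φ u k (h₁ q) = g' (q.2, signal φ y k (h₁ q)) := fun k q => hg₁ q _
  have hn0 : 0 < n := hn ▸ Nat.card_pos
  have hgex := exists_independent_randomization μ (WGame.deviceLaw N) n
    (Z := fun k q => signal φ y k (h₁ q)) hg' (hF₀ hn0) hF (fun k _ => hr k)
    (fun h q => hdyn₀ h _ _ (hh₁ q))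
    (fun k hk q => by rw [hdyn k hk _ _ (hh₁ q), hact])
    (fun k hk q => by rw [hr' k hk, hact])
  have hgex' : ∀ k, ∃ γ : (N × unitInterval) × unitInterval → unitInterval, Measurable γ ∧
      (k < n → ∀ G : X × (N × unitInterval) × unitInterval → ENNReal, Measurable G →
      ∫⁻ q, G (q.1, signal φ y k (h₁ q), actionAt φ u k (h₁ q)) ∂(μ.prod (WGame.deviceLaw N)) =
        ∫⁻ q, ∫⁻ c, G (q.1, signal φ y k (h₁ q), γ (signal φ y k (h₁ q), c)) ∂volume
          ∂(μ.prod (WGame.deviceLaw N))) := by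
    intro k
    by_cases hk : k < n
    · obtain ⟨γ, hγ, hγ'⟩ := hgex k hk
      refine ⟨γ, hγ, fun _ G hG => ?_⟩
      simp only [hact]
      exact hγ' G hG
    · exact ⟨fun _ => 0, measurable_const, fun h => absurd h hk⟩
  choose γ hγ hγ' using hgex'
  have hprojm : Measurable fun z : N × unitInterval => proj z.1 z.2 :=
    measurable_from_prod_countable_right hproj
  -- only codes of actions are used: this does not affect the laws
  have hγp : ∀ k, Measurable fun z : (N × unitInterval) × unitInterval =>
      proj z.1.1 (γ k z) := fun k => by
    have := hγ k
    exact hprojm.comp (by fun_prop :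
      Measurable fun z : (N × unitInterval) × unitInterval => (z.1.1, γ k z))
  refine ⟨fun k z => proj z.1.1 (γ k z), hγp, fun k z => hproj_idem _ _, ?_⟩
  intro h₂ hh₂m hh₂ hγ₂ G hG
  have hlast : ∀ x h, R (x, fun b => u b h) = h →
      R (x, reconstruct r (n - 1) (signal φ y (n - 1) h, actionAt φ u (n - 1) h)) = h := by
    intro x h hh
    rw [hrecon h (n - 1) (by omega), Nat.sub_add_cancel hn0, pastActions_all hn, hh]
  have hrm' := hrm (n - 1)
  have hmain := lintegral_eq_of_independent_randomization μ n
    (Z := fun k q => signal φ y k (h₁ q)) (Z' := fun k q => signal φ y k (h₂ q))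
    (fun k hk => (hrec.measurable_signal hy hk).comp hh₂m)
    (u := fun k q => actionAt φ u k (h₁ q)) (γ := fun k z => proj z.1.1 (γ k z)) (fun k _ => hγp k)
    (sel := Prod.fst) measurable_fst hF
    (fun h q => hdyn₀ h _ _ (hh₁ q)) (fun k hk q => hdyn k hk _ _ (hh₁ q))
    (fun h q => hdyn₀ h _ _ (hh₂ q))
    (fun k hk q => by
      rw [hdyn k hk _ _ (hh₂ q), hγ₂ k (by omega)]; rfl)
    (fun i j hij hj q => agentAt_ne φ hij hj _)
    (fun k hk G hG => by
      have := hγ' k hk (fun z => G (z.1, z.2.1, proj z.2.1.1 z.2.2)) (hG.comp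
        (measurable_fst.prodMk (measurable_snd.fst.prodMk (hprojm.comp
          (measurable_snd.fst.fst.prodMk measurable_snd.snd)))))
      refine Eq.trans ?_ this
      refine lintegral_congr fun q => ?_
      dsimp only
      rw [actionAt, signal, hproj_u])
    (show n - 1 < n by omega)
    (G := fun z => G (R (z.1, reconstruct r (n - 1) z.2))) (by fun_prop)
  have e1 : ∀ q, G (h₁ q) = G (R (q.1, reconstruct r (n - 1)
      (signal φ y (n - 1) (h₁ q), actionAt φ u (n - 1) (h₁ q)))) := fun q => by
    rw [hlast _ _ (hh₁ q)]
  have e2 : ∀ q, G (h₂ q) = G (R (q.1, reconstruct r (n - 1)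
      (signal φ y (n - 1) (h₂ q), actionAt φ u (n - 1) (h₂ q)))) := fun q => by
    rw [hlast _ _ (hh₂ q)]
  rw [lintegral_congr e1, lintegral_congr e2]
  refine hmain.trans (lintegral_congr fun q => ?_)
  rw [hγ₂ _ (by omega)]
  rfl

/-! ### Solutions of a playable W-model -/

namespace WModel

variable {A Ω : Type*} {U : A → Type*} [MeasurableSpace Ω] [∀ a, MeasurableSpace (U a)]
  {M : WModel A Ω U}

theorem solution_apply (hM : M.Playable) (s : ∀ a, M.PureStrategy a) (ω : Ω) (a : A) :
    (solution hM s ω).1 a = (s a).1 (solution hM s ω) :=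
  (hM s ω).choose_spec.1 a

theorem eq_solution (hM : M.Playable) {s : ∀ a, M.PureStrategy a} {ω : Ω} {h : Config Ω U}
    (hω : h.2 = ω) (hs : ∀ a, h.1 a = (s a).1 h) : h = solution hM s ω := by
  subst hω
  exact Prod.ext ((hM s h.2).unique (y₁ := h.1) hs (hM s h.2).choose_spec.1) rfl

theorem Playable.nonempty_action (hM : M.Playable) [Nonempty Ω] (a : A) : Nonempty (U a) := by
  by_contra hne
  rw [not_nonempty_iff] at hne
  have hC : IsEmpty (Config Ω U) := ⟨fun h => hne.elim (h.1 a)⟩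
  obtain ⟨v, -, -⟩ := hM (fun b => ⟨fun h => hC.elim h, fun S _ => by
    rw [show (fun h => hC.elim h) ⁻¹' S = ∅ from Set.eq_empty_of_isEmpty _]
    exact @MeasurableSet.empty _ (M.info b)⟩) (Classical.arbitrary Ω)
  exact hne.elim (v a)

open Classical in
/-- Playability forbids self-information: otherwise the agent `a` could contradict her own
action, by playing `c'` on the event `K` and `c` outside of it. -/
theorem solution_mem_of_mem (hM : M.Playable) (s : ∀ a, M.PureStrategy a) (ω : Ω) (a : A)
    (c c' : U a) {K : Set (Config Ω U)} (hK : MeasurableSet[M.info a] K)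
    (hc : solution hM (Function.update s a (M.constStrategy a c)) ω ∈ K) :
    solution hM (Function.update s a (M.constStrategy a c')) ω ∈ K := by
  let t : M.PureStrategy a := ⟨fun h => if h ∈ K then c' else c,
    @Measurable.ite _ _ _ _ (M.info a) _ (fun h => h ∈ K) _ hK
      (@measurable_const _ _ _ (M.info a) c') (@measurable_const _ _ _ (M.info a) c)⟩
  have ht := solution_apply hM (Function.update s a t) ω
  have hcon : ∀ d, (t.1 (solution hM (Function.update s a t) ω) = d) →
      solution hM (Function.update s a t) ω =
        solution hM (Function.update s a (M.constStrategy a d)) ω := by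
    intro d hd
    refine eq_solution hM rfl fun b => ?_
    by_cases hb : b = a
    · subst hb
      have := ht b
      rw [Function.update_self] at this
      rw [Function.update_self, this, hd]
      rfl
    · have := ht b
      rw [Function.update_of_ne hb] at this
      rw [Function.update_of_ne hb, this]
  by_cases hm : solution hM (Function.update s a t) ω ∈ K
  · rw [← hcon c' (if_pos hm)]
    exact hm
  · rw [hcon c (if_neg hm)] at hm
    exact absurd hc hm

open Classical in
theorem partialSolution_mem_of_mem (hM : M.Playable) (B : Set A) (s : ∀ a, M.PureStrategy a)
    (ω : Ω) (v v' : ∀ b : B, U b) (a : B) (hv : ∀ b ≠ a, v b = v' b) {K : Set (Config Ω U)}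
    (hK : MeasurableSet[M.info a] K) (hc : partialSolution hM B s (ω, v) ∈ K) :
    partialSolution hM B s (ω, v') ∈ K := by
  have key : ∀ v'' : ∀ b : B, U b, (∀ b ≠ a, v b = v'' b) → partialSolution hM B s (ω, v'') =
      solution hM (Function.update (fun b => if h : b ∈ B then M.constStrategy b (v ⟨b, h⟩) else s b)
        a (M.constStrategy a (v'' a))) ω := by
    intro v'' h''
    unfold partialSolution
    congr 1
    funext b
    by_cases hb : b = a
    · subst hb; simp
    · rw [Function.update_of_ne hb]
      by_cases hB : b ∈ B
      · simp only [hB, dite_true]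
        rw [h'' ⟨b, hB⟩ fun e => hb (congrArg Subtype.val e)]
      · simp only [hB, dite_false]
  rw [key v' hv]
  rw [key v fun _ _ => rfl] at hc
  exact solution_mem_of_mem hM _ ω a _ _ hK hc

end WModel

/-! ### Randomized strategies -/

namespace WGame

variable {P A Ω : Type*} {U : A → Type*} [MeasurableSpace Ω] [∀ a, MeasurableSpace (U a)]
  {G : WGame P A Ω U}

theorem MixedProfile.replace_pure_of_mem (m : G.MixedProfile) (p : P) (q : G.MixedStrategy p)
    (w : A → unitInterval) {a : A} (ha : a ∈ G.agents p) (h : Config Ω U) :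
    ((m.replace p q).pure w a).1 h = q.1 ⟨a, ha⟩ (fun b => w b, h) := by
  obtain rfl : G.owner a = p := ha
  simp [MixedProfile.pure, MixedProfile.replace]

theorem MixedProfile.replace_pure_of_notMem (m : G.MixedProfile) (p : P) (q : G.MixedStrategy p)
    {w w' : A → unitInterval} (hw : ∀ b ∉ G.agents p, w b = w' b) {a : A} (ha : a ∉ G.agents p)
    (h : Config Ω U) :
    ((m.replace p q).pure w a).1 h = (m.pure w' a).1 h := by
  classical
  have hne : G.owner a ≠ p := ha
  have hww : (fun b : G.agents (G.owner a) => w b) = fun b : G.agents (G.owner a) => w' b := by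
    funext b
    refine hw b fun hb => hne ?_
    exact (show G.owner b = G.owner a from b.2).symm.trans hb
  have hm : m.replace p q (G.owner a) = m (G.owner a) := Function.update_of_ne hne _ _
  simp only [MixedProfile.pure, hm, hww]

theorem MixedProfile.replace_self (m : G.MixedProfile) (p : P) : m.replace p (m p) = m := by
  classical
  exact Function.update_eq_self p m

/-- The outcome when the player `p` uses the strategy `q` with her own device, the devices of the
other players being part of the environment. -/
noncomputable def MixedProfile.splitOutcome (m : G.MixedProfile) (hG : G.toWModel.Playable) (p : P)
    (q : G.MixedStrategy p) (x : (Ω × (A → unitInterval)) × G.Device p) : Config Ω U :=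
  (m.replace p q).outcome hG (x.1.1, overrideOn (G.agents p) x.1.2 x.2)

theorem MixedProfile.measurable_splitOutcome (m : G.MixedProfile) {hG : G.toWModel.Playable}
    (hmeas : IsMeasurable hG) (p : P) (q : G.MixedStrategy p) :
    Measurable (m.splitOutcome hG p q) := by
  have h1 : Measurable fun x : (Ω × (A → unitInterval)) × G.Device p =>
      overrideOn (G.agents p) x.1.2 x.2 :=
    (measurable_overrideOn (G.agents p)).comp (by fun_prop :
      Measurable fun x : (Ω × (A → unitInterval)) × G.Device p => (x.1.2, x.2))
  exact (hmeas (m.replace p q)).comp (measurable_fst.fst.prodMk h1)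

theorem MixedProfile.lintegral_law_replace (m : G.MixedProfile) {hG : G.toWModel.Playable}
    (hmeas : IsMeasurable hG) (p : P) (q : G.MixedStrategy p) (ν : Measure Ω) [SFinite ν]
    {Φ : Config Ω U → ENNReal} (hΦ : Measurable Φ) :
    ∫⁻ h, Φ h ∂law hG ν (m.replace p q) =
      ∫⁻ x, Φ (m.splitOutcome hG p q x) ∂((ν.prod (deviceLaw A)).prod (deviceLaw (G.agents p))) := by
  have hm := hmeas (m.replace p q)
  have h1 := m.measurable_splitOutcome hmeas p q
  have h2 : ∀ ω, Measurable fun w => Φ ((m.replace p q).outcome hG (ω, w)) := fun ω => by fun_prop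
  rw [law, lintegral_map hΦ hm,
    lintegral_prod (fun z => Φ ((m.replace p q).outcome hG z)) (hΦ.comp hm).aemeasurable,
    lintegral_prod (fun x => Φ (m.splitOutcome hG p q x)) (hΦ.comp h1).aemeasurable, lintegral_prod]
  · refine lintegral_congr fun ω => ?_
    conv_lhs => rw [← map_overrideOn (G.agents p)]
    rw [lintegral_map (h2 ω) (measurable_overrideOn _)]
    exact lintegral_prod _ ((h2 ω).comp (measurable_overrideOn _)).aemeasurable
  · exact ((hΦ.comp h1).lintegral_prod_right').aemeasurable

/-- In the closed loop, each agent of `p` plays according to `q`. -/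
theorem MixedProfile.splitOutcome_apply (m : G.MixedProfile) (hG : G.toWModel.Playable) (p : P)
    (q : G.MixedStrategy p) (x : (Ω × (A → unitInterval)) × G.Device p) (a : G.agents p) :
    (m.splitOutcome hG p q x).1 a = q.1 a (x.2, m.splitOutcome hG p q x) := by
  have h1 := WModel.solution_apply hG
    ((m.replace p q).pure (overrideOn (G.agents p) x.1.2 x.2)) x.1.1 a
  rw [m.replace_pure_of_mem p q _ a.2, overrideOn_coe] at h1
  exact h1

/-- The environment of `p`, as a map from the state of Nature, the devices of the other players and
the actions of `p`, reproduces the outcome of each strategy of `p`. -/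
theorem MixedProfile.partialSolution_eq_splitOutcome (m : G.MixedProfile)
    (hG : G.toWModel.Playable) (p : P) (q : G.MixedStrategy p)
    (x : (Ω × (A → unitInterval)) × G.Device p) (v : ∀ a : G.agents p, U a)
    (hv : ∀ a, v a = (m.splitOutcome hG p q x).1 a) :
    WModel.partialSolution hG (G.agents p) (m.pure x.1.2) (x.1.1, v) =
      m.splitOutcome hG p q x := by
  symm
  refine WModel.eq_solution hG rfl fun a => ?_
  by_cases ha : a ∈ G.agents p
  · simp only [ha, dite_true]
    exact (hv ⟨a, ha⟩).symm
  · simp only [ha, dite_false]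
    refine (WModel.solution_apply hG
      ((m.replace p q).pure (overrideOn (G.agents p) x.1.2 x.2)) x.1.1 a).trans ?_
    refine m.replace_pure_of_notMem p q (fun b hb => ?_) ha _
    simp [overrideOn, hb]

theorem BorelInformation.exists_encoding {p : P} (h : BorelInformation.{w} G p) :
    ∃ y : G.agents p → Config Ω U → unitInterval, ∀ a, Measurable (y a) ∧
      MeasurableSpace.comap (y a) inferInstance = G.info a := by
  obtain ⟨Z, mZ, f, hf⟩ := h
  refine ⟨fun a => ?_, fun a => ?_⟩
  · have := (hf a).1
    exact (unitInterval.sigmoid ∘ embeddingReal (Z a)) ∘ f a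
  · obtain ⟨h1, h2, h3⟩ := hf a
    have he := measurableEmbedding_sigmoid_comp_embeddingReal (Z a)
    refine ⟨he.measurable.comp h2, ?_⟩
    rw [← h3, ← he.comap_eq, MeasurableSpace.comap_comp]

theorem PerfectRecall.exists_orderedRecall {p : P} (h : G.PerfectRecall p)
    {y : G.agents p → Config Ω U → unitInterval}
    (hy : ∀ a, MeasurableSpace.comap (y a) inferInstance = G.info a)
    {enc : ∀ a : G.agents p, U a → unitInterval} (henc : ∀ a, MeasurableEmbedding (enc a)) :
    ∃ φ : Config Ω U → Fin (Nat.card (G.agents p)) ↪ G.agents p,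
      OrderedRecall φ y fun a c => enc a (c.1 a) := by
  obtain ⟨φ, hφ⟩ := h
  refine ⟨φ, fun k hk κ S hS => ?_⟩
  rw [hy]
  refine hφ k hk κ S ?_
  convert hS using 3 with i
  rw [hy, WModel.choiceField, ← (henc _).comap_eq, MeasurableSpace.comap_comp]
  rfl

end WGame

/-! ### Product fields with pulled-back factors -/

theorem measurable_prodMap_comap {X Y X' Y' : Type*} [MeasurableSpace X'] [MeasurableSpace Y']
    (f : X → X') (g : Y → Y') :
    Measurable[(MeasurableSpace.comap f inferInstance).prod
      (MeasurableSpace.comap g inferInstance)] (fun z : X × Y => (f z.1, g z.2)) := by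
  let _ := MeasurableSpace.comap f inferInstance
  let _ := MeasurableSpace.comap g inferInstance
  exact ((comap_measurable f).comp measurable_fst).prodMk ((comap_measurable g).comp measurable_snd)

theorem prod_comap_right_eq {X Y Y' : Type*} [mX : MeasurableSpace X] [MeasurableSpace Y']
    (g : Y → Y') :
    mX.prod (MeasurableSpace.comap g inferInstance) =
      MeasurableSpace.comap (fun z : X × Y => (z.1, g z.2)) inferInstance := by
  unfold Prod.instMeasurableSpace
  rw [MeasurableSpace.prod, MeasurableSpace.prod, MeasurableSpace.comap_sup,
    MeasurableSpace.comap_comp, MeasurableSpace.comap_comp, MeasurableSpace.comap_comp]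
  rfl

/-! ### Kuhn's theorem -/

theorem mainTheorem1 {P A Ω : Type*} {U : A → Type*} [MeasurableSpace Ω]
    [∀ a, MeasurableSpace (U a)] (G : WGame P A Ω U) (p : P)
    (hplay : G.toWModel.Playable)
    (hmeas : WGame.IsMeasurable hplay)
    (hstrong : WModel.StronglyMeasurableOn hplay (G.agents p))
    (hinfo : WGame.BorelInformation.{w} G p)
    (hfin : (G.agents p).Finite)
    (hU : ∀ a ∈ G.agents p, StandardBorelSpace (U a))
    (hΩ : StandardBorelSpace Ω)
    (hrecall : G.PerfectRecall p)
    (ν : Measure Ω) (hν : IsProbabilityMeasure ν)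
    (m : G.MixedProfile) :
    ∃ m' : G.MixedStrategy p, m'.IsBehavioral ∧
      WGame.law hplay ν m = WGame.law hplay ν (m.replace p m') := by
  classical
  have : Finite (G.agents p) := hfin.to_subtype
  have : Nonempty (G.agents p) := let ⟨a, ha⟩ := G.owner_surjective p; ⟨⟨a, ha⟩⟩
  have : Nonempty Ω := nonempty_of_isProbabilityMeasure ν
  have : ∀ a, Nonempty (U a) := hplay.nonempty_action
  have : ∀ a : G.agents p, StandardBorelSpace (U a) := fun a => hU a a.2
  let _ : MeasurableSpace (G.agents p) := ⊤
  have : DiscreteMeasurableSpace (G.agents p) := ⟨fun _ => trivial⟩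
  -- information and actions are encoded in the unit interval
  obtain ⟨y, hy⟩ := hinfo.exists_encoding
  have hym : ∀ a, Measurable (y a) := fun a => (hy a).1
  have hyi : ∀ a, MeasurableSpace.comap (y a) inferInstance = G.info a := fun a => (hy a).2
  let enc : ∀ a : G.agents p, U a → unitInterval := fun a =>
    unitInterval.sigmoid ∘ embeddingReal (U a)
  have henc : ∀ a, MeasurableEmbedding (enc a) := fun a =>
    measurableEmbedding_sigmoid_comp_embeddingReal (U a)
  have hdec : ∀ a : G.agents p, ∃ d : unitInterval → U a, Measurable d ∧ ∀ c, d (enc a c) = c := by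
    intro a
    obtain ⟨d, hd, hd'⟩ := (henc a).exists_measurable_extend measurable_id fun _ => inferInstance
    exact ⟨d, hd, congrFun hd'⟩
  choose dec hdecm hdec using hdec
  let u : G.agents p → Config Ω U → unitInterval := fun a h => enc a (h.1 a)
  obtain ⟨φ, hφ⟩ := hrecall.exists_orderedRecall hyi henc
  obtain ⟨pos, hposm, hpos⟩ := hφ.exists_position rfl
  -- the response of the environment to encoded actions of the player
  let R : (Ω × (A → unitInterval)) × G.Device p → Config Ω U := fun x =>
    WModel.partialSolution hplay (G.agents p) (m.pure x.1.2) (x.1.1, fun a => dec a (x.2 a))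
  have hRq : ∀ (q : G.MixedStrategy p) x,
      R (x.1, fun a => u a (m.splitOutcome hplay p q x)) = m.splitOutcome hplay p q x :=
    fun q x => m.partialSolution_eq_splitOutcome hplay p q x _ fun a => hdec a _
  -- `R` is measurable, being the outcome of the strategy that plays what the device says
  let q₀ : G.MixedStrategy p := ⟨fun a z => dec a (z.1 a), fun a =>
    (show Measurable fun w : G.Device p => dec a (w a) from
      (hdecm a).comp (measurable_pi_apply a)).comp (@measurable_fst _ _ _ (G.info a))⟩
  have hR₀ : ∀ x, R x = m.splitOutcome hplay p q₀ x := fun x =>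
    m.partialSolution_eq_splitOutcome hplay p q₀ x _ fun a =>
      (m.splitOutcome_apply hplay p q₀ x a).symm
  have hR : Measurable R := by
    rw [funext hR₀]
    exact m.measurable_splitOutcome hmeas p q₀
  have hself : ∀ x v v' a, (∀ b ≠ a, v b = v' b) → y a (R (x, v)) = y a (R (x, v')) := by
    intro x v v' a hv
    have hK : MeasurableSet[G.info a] (y a ⁻¹' {y a (R (x, v))}) := by
      rw [← hyi]
      exact ⟨_, measurableSet_singleton _, rfl⟩
    have h1 := WModel.partialSolution_mem_of_mem hplay (G.agents p) (m.pure x.2) x.1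
      (fun b => dec b (v b)) (fun b => dec b (v' b)) a (fun b hb => by rw [hv b hb]) hK rfl
    exact (show y a (R (x, v')) = y a (R (x, v)) from h1).symm
  -- the given mixed strategy as a function of the encoded information
  have hg : ∀ a : G.agents p, ∃ f : G.Device p × unitInterval → U a, Measurable f ∧
      ∀ w h, (m p).1 a (w, h) = f (w, y a h) := by
    intro a
    have h1 := (m p).2 a
    rw [← hyi, prod_comap_right_eq] at h1
    obtain ⟨f, hf, hf'⟩ := h1.exists_eq_measurable_comp
    exact ⟨f, hf, fun w h => congrFun hf' (w, h)⟩
  choose g hgm hg using hg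
  obtain ⟨γ, hγm, hγproj, hγ⟩ := exists_response_lintegral_eq (ν.prod (WGame.deviceLaw A)) rfl hφ hym
    (proj := fun a c => enc a (dec a c)) (fun a => (henc a).measurable.comp (hdecm a))
    (fun a c => by rw [hdec]) (fun a h => by rw [hdec]) hR hself
    (g := fun a z => enc a (g a z)) (fun a => (henc a).measurable.comp (hgm a))
    (hRq (m p)) (fun x a => by rw [m.splitOutcome_apply, hg])
  -- each agent answers her information with her own device
  let Φ : ∀ a : G.agents p, unitInterval × unitInterval → U a := fun a z =>
    dec a (γ (pos a z.2) ((a, z.2), z.1))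
  have hΦ : ∀ a, Measurable (Φ a) := by
    intro a
    have h1 : Measurable fun z : ℕ × (G.agents p × unitInterval) × unitInterval => γ z.1 z.2 :=
      measurable_from_prod_countable_right hγm
    have h2 := hposm a
    exact (hdecm a).comp (h1.comp (by fun_prop :
      Measurable fun z : unitInterval × unitInterval => (pos a z.2, (a, z.2), z.1)))
  have hbeh : ∀ a : G.agents p,
      Measurable[(MeasurableSpace.comap (fun w : G.Device p => w a) inferInstance).prod (G.info a)]
        fun z : G.Device p × Config Ω U => Φ a (z.1 a, y a z.2) := by
    intro a
    rw [← hyi]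
    exact (hΦ a).comp (measurable_prodMap_comap (fun w : G.Device p => w a) (y a))
  let m' : G.MixedStrategy p := ⟨fun a z => Φ a (z.1 a, y a z.2), fun a =>
    (hbeh a).mono (sup_le_sup_right
      (MeasurableSpace.comap_mono (measurable_pi_apply a).comap_le) _) le_rfl⟩
  refine ⟨m', hbeh, ?_⟩
  have hu' : ∀ k < Nat.card (G.agents p), ∀ x,
      actionAt φ u k (m.splitOutcome hplay p m' x) =
        γ k (signal φ y k (m.splitOutcome hplay p m' x),
          x.2 (agentAt φ k (m.splitOutcome hplay p m' x))) := by
    intro k hk x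
    have h1 := m.splitOutcome_apply hplay p m' x (agentAt φ k (m.splitOutcome hplay p m' x))
    simp only [actionAt, u]
    rw [h1]
    simp only [m', Φ]
    rw [hpos _ k hk]
    exact hγproj k (signal φ y k (m.splitOutcome hplay p m' x),
      x.2 (agentAt φ k (m.splitOutcome hplay p m' x)))
  have hlaw := hγ (m.splitOutcome hplay p m') (m.measurable_splitOutcome hmeas p m') (hRq m') hu'
  have hext : ∀ S, MeasurableSet S →
      WGame.law hplay ν (m.replace p (m p)) S = WGame.law hplay ν (m.replace p m') S := by
    intro S hS
    have hind : Measurable (S.indicator (1 : Config Ω U → ENNReal)) :=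
      measurable_one.indicator hS
    rw [← lintegral_indicator_one hS, ← lintegral_indicator_one hS,
      m.lintegral_law_replace hmeas p _ ν hind, m.lintegral_law_replace hmeas p _ ν hind]
    exact hlaw _ hind
  rw [m.replace_self] at hext
  exact Measure.ext hext
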